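/- All spaces are Tychonoff. A subset $C$ of a space $X$ is regularly closed if $C=\overline{\operatorname{Int} C}$. A quasi $\kappa$-metric on $X$ is a function $\rho(x,C)\in[0,\infty)$, defined for $x\in X$ and $C\subset X$ regularly closed, such that: (K1)* for every $C$ there is a dense open subset $V$ of $X\setminus C$ such that $\rho(x,C)>0$ if and only if $x\in V$; (K2) if $C\subset C'$, then $\rho(x,C')\le\rho(x,C)$ for every $x\in X$; (K3) for every $C$ the function $x\mapsto\rho(x,C)$ is continuous; (K4) $\rho\bigl(x,\overline{\bigcup_\alpha C_\alpha}\bigr)=\inf_\alpha\rho(x,C_\alpha)$ for every $x\in X$ and every non-empty increasing transfinite (i.e. indexed by a well-ordered set) family $\{C_\alpha\}$ of regularly closed sets. It is regular if moreover (K5) $\rho(x,C)\le\rho(x,C')+\sup\{\rho(y,C):y\in C'\}$ for every $x\in X$ and all regularly closed $C,C'$, where the supremum is taken in $[0,\infty]$ (so that it is $0$ for $C'=\varnothing$). The space $X$ is called (regularly) quasi $\kappa$-metrizable if it admits a (regular) quasi $\kappa$-metric. Let $\exp X$ be the set of all non-empty compact subsets of $X$ with the Vietoris topology, i.e. the topology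 with base the sets $[U_1,\dots,U_k]=\{H\in\exp X: H\subset\bigcup_{i=1}^k U_i\text{ and }H\cap U_i\ne\varnothing\text{ for all }i\}$, where $k\ge 1$ and $U_1,\dots,U_k\subset X$ are open. **Proposition.** Let $X$ be a Tychonoff space. If $X$ is quasi $\kappa$-metrizable, then $\exp X$ is quasi $\kappa$-metrizable. If $X$ is regularly quasi $\kappa$-metrizable, then $\exp X$ is regularly quasi $\kappa$-metrizable. -/

import Mathlib

open Set TopologicalSpace
open scoped NNReal ENNReal

universe u

/-- A set is regularly closed if it is the closure of its interior. -/
def IsRegularlyClosed {X : Type u} [TopologicalSpace X] (C : Set X) : Prop :=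
  closure (interior C) = C

/-- `ρ` is a quasi κ-metric on `X`: a non-negative function `ρ x C` of a point `x` and a regularly
closed set `C` satisfying the four axioms below. The second argument is formally an arbitrary set,
but only the values at regularly closed sets matter. -/
structure IsQuasiKappaMetric {X : Type u} [TopologicalSpace X] (ρ : X → Set X → ℝ≥0) : Prop where
  /-- The positivity set of `ρ · C` is a dense open subset of `X \ C`
  (as `C` is closed, open in `X \ C` and open in `X` are the same). -/
  pos_iff : ∀ C : Set X, IsRegularlyClosed C →
    ∃ V : Set X, IsOpen V ∧ V ⊆ Cᶜ ∧ Cᶜ ⊆ closure V ∧ ∀ x, 0 < ρ x C ↔ x ∈ V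
  /-- Monotonicity. -/
  anti : ∀ C C' : Set X, IsRegularlyClosed C → IsRegularlyClosed C' → C ⊆ C' →
    ∀ x, ρ x C' ≤ ρ x C
  /-- Continuity in the point. -/
  cont : ∀ C : Set X, IsRegularlyClosed C → Continuous fun x => ρ x C
  /-- Increasing transfinite families, that is, families indexed by a non-empty well-ordered set. -/
  closure_iUnion : ∀ (ι : Type u) [LinearOrder ι] [WellFoundedLT ι] [Nonempty ι] (C : ι → Set X),
    (∀ i, IsRegularlyClosed (C i)) → Monotone C →
    ∀ x, ρ x (closure (⋃ i, C i)) = ⨅ i, ρ x (C i)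

/-- A quasi κ-metric is regular if `ρ(x,C) ≤ ρ(x,C') + sup {ρ(y,C) : y ∈ C'}` always holds. The
supremum is taken in `[0,∞]`, so it is `∞` if `ρ · C` is unbounded on `C'`, and `0` if `C' = ∅`. -/
structure IsRegularQuasiKappaMetric {X : Type u} [TopologicalSpace X] (ρ : X → Set X → ℝ≥0) : Prop
    extends IsQuasiKappaMetric ρ where
  le_add_sup : ∀ C C' : Set X, IsRegularlyClosed C → IsRegularlyClosed C' →
    ∀ x, (ρ x C : ℝ≥0∞) ≤ (ρ x C' : ℝ≥0∞) + ⨆ y ∈ C', (ρ y C : ℝ≥0∞)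

/-- A space is quasi κ-metrizable if it admits a quasi κ-metric. -/
def QuasiKappaMetrizable (X : Type u) [TopologicalSpace X] : Prop :=
  ∃ ρ : X → Set X → ℝ≥0, IsQuasiKappaMetric ρ

/-- A space is regularly quasi κ-metrizable if it admits a regular quasi κ-metric. -/
def RegularlyQuasiKappaMetrizable (X : Type u) [TopologicalSpace X] : Prop :=
  ∃ ρ : X → Set X → ℝ≥0, IsRegularQuasiKappaMetric ρ

/-! The distance from `K` to `𝒞` is the supremum of the scales `ε` at which a base set `D` and sets
`C i` certify that `K` lies in an open Vietoris box missing `𝒞`. Disjointness from `D` is measured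
by the minimum of `ρ · D` on `K`, non-inclusion in `C i` by the maximum of `ρ · (C i)`.

At scale `ε` at most `1 / ε` of the `C i` differ from `D`. This uniform bound makes witnesses pass
to limits along ultrafilters (`IsDistanceWitness.regularLimit`), by two facts: lower bounds on `ρ`
survive regularly closed limits, since (K4) extends to arbitrary families (`le_closure_iUnion`), and
so does disjointness of the boxes from `𝒞` (`disjoint_box_regularLimit`).

Limits with `𝒞` fixed give upper semicontinuity in `K`; limits with `K` fixed give (K4). Lower
semicontinuity comes from continuity of `ρ`, and density in (K1) from finite sets `K`. For (K5), the
sets of a witness are enlarged to sublevel sets of their distance functions. -/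

open Filter Topology Cardinal

/-! ### Regularly closed sets and their limits along filters. -/

section RegularlyClosed

variable {X : Type u} [TopologicalSpace X]

theorem IsRegularlyClosed.isClosed {C : Set X} (h : IsRegularlyClosed C) : IsClosed C :=
  h ▸ isClosed_closure

theorem IsOpen.isRegularlyClosed_closure {U : Set X} (h : IsOpen U) :
    IsRegularlyClosed (closure U) :=
  (closure_minimal interior_subset isClosed_closure).antisymm
    (closure_mono (interior_maximal subset_closure h))

theorem isRegularlyClosed_empty : IsRegularlyClosed (∅ : Set X) := by
  simp [IsRegularlyClosed]

theorem IsRegularlyClosed.closure_iUnion {ι : Sort*} {C : ι → Set X}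
    (h : ∀ i, IsRegularlyClosed (C i)) : IsRegularlyClosed (closure (⋃ i, C i)) := by
  refine (closure_minimal interior_subset isClosed_closure).antisymm
    (closure_minimal (iUnion_subset fun i => ?_) isClosed_closure)
  exact (h i).ge.trans (closure_mono (interior_mono ((subset_iUnion C i).trans subset_closure)))

theorem IsRegularlyClosed.biUnion_finset {ι : Type*} {C : ι → Set X}
    (h : ∀ i, IsRegularlyClosed (C i)) (F : Finset ι) : IsRegularlyClosed (⋃ i ∈ F, C i) := by
  have hcl : IsClosed (⋃ i ∈ F, C i) := F.finite_toSet.isClosed_biUnion fun i _ => (h i).isClosed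
  have := IsRegularlyClosed.closure_iUnion (C := fun i : F => C i) fun i => h i
  rwa [iUnion_subtype, hcl.closure_eq] at this

/-- The regularly closed limit of a family of sets along a filter: the closure of the set of points
with a neighbourhood that is eventually contained in the members of the family. -/
def regularLimit {I : Type*} (l : Filter I) (A : I → Set X) : Set X :=
  closure {p | ∃ G ∈ 𝓝 p, ∀ᶠ n in l, G ⊆ A n}

theorem isRegularlyClosed_regularLimit {I : Type*} (l : Filter I) (A : I → Set X) :
    IsRegularlyClosed (regularLimit l A) := by
  refine IsOpen.isRegularlyClosed_closure (isOpen_iff_mem_nhds.2 ?_)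
  rintro p ⟨G, hG, h⟩
  filter_upwards [eventually_mem_nhds_iff.2 hG] with q hq using ⟨G, hq, h⟩

theorem regularLimit_mono {I : Type*} {l : Filter I} {A B : I → Set X} (h : ∀ n, A n ⊆ B n) :
    regularLimit l A ⊆ regularLimit l B :=
  closure_mono fun _ ⟨G, hG, hA⟩ => ⟨G, hG, hA.mono fun n hn => hn.trans (h n)⟩

theorem subset_regularLimit {I : Type*} {l : Filter I} {A : I → Set X} {B : Set X}
    (hB : IsRegularlyClosed B) (h : ∀ᶠ n in l, B ⊆ A n) : B ⊆ regularLimit l A := by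
  rw [← hB]
  exact closure_mono fun p hp => ⟨B, mem_interior_iff_mem_nhds.1 hp, h⟩

theorem regularLimit_pure {I : Type*} (a : I) (A : I → Set X) :
    regularLimit (pure a) A = closure (interior (A a)) := by
  refine congrArg closure (Set.ext fun p => ?_)
  rw [mem_interior_iff_mem_nhds]
  exact ⟨fun ⟨G, hG, h⟩ => mem_of_superset hG h, fun h => ⟨_, h, eventually_pure.2 subset_rfl⟩⟩

theorem eventually_not_subset_of_notMem_regularLimit {I : Type*} {l : Ultrafilter I}
    {A : I → Set X} {p : X} (hp : p ∉ regularLimit (l : Filter I) A) {G : Set X} (hG : G ∈ 𝓝 p) :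
    ∀ᶠ n in (l : Filter I), ¬ G ⊆ A n :=
  Ultrafilter.eventually_not.2 fun h => hp (subset_closure ⟨G, hG, h⟩)

end RegularlyClosed

/-! ### Lower bounds for `ρ` on limits of sets. -/

namespace IsQuasiKappaMetric

variable {X : Type u} [TopologicalSpace X] {ρ : X → Set X → ℝ≥0}

/-- The axiom on increasing transfinite families extends to arbitrary families, through their finite
unions. -/
theorem le_closure_iUnion (hρ : IsQuasiKappaMetric ρ) {ι : Type u} {C : ι → Set X}
    (hC : ∀ i, IsRegularlyClosed (C i)) {ε : ℝ≥0} {x : X}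
    (h : ∀ F : Finset ι, ε ≤ ρ x (⋃ i ∈ F, C i)) : ε ≤ ρ x (closure (⋃ i, C i)) := by
  induction hκ : #ι using WellFoundedLT.induction generalizing ι with
  | ind κ ih =>
    subst hκ
    rcases finite_or_infinite ι with hι | hι
    · have := Fintype.ofFinite ι
      have hcl : IsClosed (⋃ i, C i) := isClosed_iUnion_of_finite fun i => (hC i).isClosed
      simpa [hcl.closure_eq] using h Finset.univ
    -- In the order type of its initial ordinal, `ι` has initial segments of smaller cardinality, to
    -- which the induction hypothesis applies.
    · obtain ⟨_, _, hord⟩ := exists_ord_eq_type_lt ι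
      have hmono : Monotone fun j : ι => closure (⋃ i : Iic j, C i) := fun j k hjk =>
        closure_mono (iUnion_subset fun i =>
          subset_iUnion (fun i : Iic k => C i) ⟨i, i.2.trans hjk⟩)
      have heq : closure (⋃ i, C i) = closure (⋃ j : ι, closure (⋃ i : Iic j, C i)) := by
        refine (closure_mono (iUnion_mono fun j => ?_)).antisymm
          (closure_minimal (iUnion_subset fun j => closure_mono ?_) isClosed_closure)
        · exact (subset_iUnion (fun i : Iic j => C i) ⟨j, le_rfl⟩).trans subset_closure
        · exact iUnion_subset fun i => subset_iUnion C i
      rw [heq, hρ.closure_iUnion ι _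
        (fun j => IsRegularlyClosed.closure_iUnion fun i : Iic j => hC i) hmono x]
      refine le_ciInf fun j => ih _ (mk_Iic_lt j hord (aleph0_le_mk ι)) (fun i => hC i) ?_ rfl
      intro F
      simpa using h (F.map (Function.Embedding.subtype _))

/-- The sets attached to `S ∈ l` are directed: a finite union of them lies in the set attached to
the intersection of the `S`. The closure of their union contains the limit. -/
theorem le_regularLimit (hρ : IsQuasiKappaMetric ρ) {I : Type u} {l : Filter I}
    {A : I → Set X} {ε : ℝ≥0} {x : X}
    (h : ∀ S ∈ l, ε ≤ ρ x (closure (interior (⋂ n ∈ S, A n)))) : ε ≤ ρ x (regularLimit l A) := by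
  have hrc : ∀ S : Set I, IsRegularlyClosed (closure (interior (⋂ n ∈ S, A n))) :=
    fun S => isOpen_interior.isRegularlyClosed_closure
  have hle := hρ.le_closure_iUnion (ι := {S // S ∈ l}) (ε := ε) (x := x) (fun S => hrc S.1) ?_
  · refine hle.trans (hρ.anti _ _ (isRegularlyClosed_regularLimit l A)
      (IsRegularlyClosed.closure_iUnion fun S : {S // S ∈ l} => hrc S.1) ?_ x)
    refine closure_mono ?_
    rintro p ⟨G, hG, hS⟩
    refine mem_iUnion.2 ⟨⟨_, hS⟩, subset_closure (mem_interior_iff_mem_nhds.2 ?_)⟩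
    exact mem_of_superset hG (subset_iInter₂ fun n hn => hn)
  · intro F
    have hF : (⋂ S ∈ F, S.1) ∈ l := (biInter_finset_mem F).2 fun S _ => S.2
    refine (h _ hF).trans (hρ.anti _ _
      (IsRegularlyClosed.biUnion_finset (fun S : {S // S ∈ l} => hrc S.1) F) (hrc _) ?_ x)
    refine iUnion₂_subset fun S hS => closure_mono (interior_mono ?_)
    exact biInter_mono (biInter_subset_of_mem (t := fun S : {S // S ∈ l} => S.1) hS)
      fun _ _ => subset_rfl

theorem eq_zero_of_mem (hρ : IsQuasiKappaMetric ρ) {C : Set X} (hC : IsRegularlyClosed C) {x : X}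
    (hx : x ∈ C) : ρ x C = 0 := by
  obtain ⟨V, -, hV, -, h⟩ := hρ.pos_iff C hC
  exact nonpos_iff_eq_zero.1 (not_lt.1 fun hpos => hV ((h x).1 hpos) hx)

/-- Lower bounds for `ρ` pass to limits, simultaneously in the point and in the closed set. -/
theorem le_regularLimit_of_tendsto (hρ : IsQuasiKappaMetric ρ) {I : Type u} {l : Filter I} [l.NeBot]
    {A : I → Set X} (hA : ∀ n, IsRegularlyClosed (A n)) {ε : ℝ≥0} {x : I → X} {y : X}
    (hx : Tendsto x l (𝓝 y)) (h : ∀ n, ε ≤ ρ (x n) (A n)) : ε ≤ ρ y (regularLimit l A) := by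
  refine hρ.le_regularLimit fun S hS => ?_
  have hrc : IsRegularlyClosed (closure (interior (⋂ n ∈ S, A n))) :=
    isOpen_interior.isRegularlyClosed_closure
  refine ge_of_tendsto (((hρ.cont _ hrc).tendsto y).comp hx) ?_
  filter_upwards [hS] with n hn
  exact (h n).trans (hρ.anti _ _ hrc (hA n) (closure_minimal
    (interior_subset.trans (biInter_subset_of_mem hn)) (hA n).isClosed) _)

end IsQuasiKappaMetric

/-! ### Vietoris convergence and boxes. -/

namespace TopologicalSpace.NonemptyCompacts

variable {X : Type u} [TopologicalSpace X]

/-- Otherwise `K` is covered by finitely many open sets that `x n` eventually avoids, although their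
union eventually contains `H n`. -/
theorem exists_tendsto_of_mem {I : Type*} {l : Ultrafilter I} {H : I → NonemptyCompacts X}
    {K : NonemptyCompacts X} (hH : Tendsto H l (𝓝 K)) {x : I → X} (hx : ∀ n, x n ∈ H n) :
    ∃ y ∈ K, Tendsto x l (𝓝 y) := by
  by_contra! hcon
  obtain ⟨U, hU, hKU, h⟩ : ∃ U : Set X, IsOpen U ∧ (K : Set X) ⊆ U ∧
      ∀ᶠ n in (l : Filter I), x n ∉ U := by
    refine K.isCompact.induction_on (p := fun s => ∃ U : Set X, IsOpen U ∧ s ⊆ U ∧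
      ∀ᶠ n in (l : Filter I), x n ∉ U) ⟨∅, isOpen_empty, subset_rfl, by simp⟩ ?_ ?_ ?_
    · rintro s t hst ⟨U, hU, htU, h⟩
      exact ⟨U, hU, hst.trans htU, h⟩
    · rintro s t ⟨U, hU, hsU, h⟩ ⟨V, hV, htV, h'⟩
      refine ⟨U ∪ V, hU.union hV, union_subset_union hsU htV, ?_⟩
      filter_upwards [h, h'] with n hn hn' using not_or.2 ⟨hn, hn'⟩
    · intro y hy
      obtain ⟨U, ⟨hyU, hU⟩, h⟩ : ∃ U, (y ∈ U ∧ IsOpen U) ∧ ¬ ∀ᶠ n in (l : Filter I), x n ∈ U := by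
        have := hcon y hy
        rw [(nhds_basis_opens y).tendsto_right_iff] at this
        push Not at this
        simpa using this
      exact ⟨U, mem_nhdsWithin_of_mem_nhds (hU.mem_nhds hyU), U, hU, subset_rfl,
        Ultrafilter.eventually_not.2 h⟩
  obtain ⟨n, hn, hn'⟩ := (h.and (hH.eventually
    ((isOpen_subsets_of_isOpen hU).mem_nhds hKU))).exists
  exact hn (hn' (hx n))

/-- The set of all `G` disjoint from `D` and not contained in any `C i`. -/
def box (D : Set X) (C : ℕ → Set X) : Set (NonemptyCompacts X) :=
  {G | Disjoint (G : Set X) D ∧ ∀ i, ¬ (G : Set X) ⊆ C i}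

theorem isOpen_box {D : Set X} {C : ℕ → Set X} (hD : IsClosed D) (hC : ∀ i, IsClosed (C i)) {N : ℕ}
    (hN : ∀ i, N ≤ i → C i = D) : IsOpen (box D C) := by
  have heq : box D C = {G : NonemptyCompacts X | (G : Set X) ⊆ Dᶜ} ∩
      ⋂ i ∈ Iio N, {G : NonemptyCompacts X | ((G : Set X) ∩ (C i)ᶜ).Nonempty} := by
    ext G
    simp only [box, mem_inter_iff, mem_iInter, Set.mem_ofPred_eq, inter_compl_nonempty_iff,
      subset_compl_iff_disjoint_right, mem_Iio]
    refine and_congr_right fun hG => ⟨fun h i _ => h i, fun h i hi => ?_⟩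
    -- From `N` on the condition is automatic: `G` is non-empty and misses `C i = D`.
    rcases lt_or_ge i N with hiN | hiN
    · exact h i hiN hi
    · rw [hN i hiN] at hi
      obtain ⟨x, hx⟩ := G.nonempty
      exact hG.notMem_of_mem_left hx (hi hx)
  rw [heq]
  exact (isOpen_subsets_of_isOpen hD.isOpen_compl).inter ((finite_Iio N).isOpen_biInter fun i _ =>
    isOpen_inter_nonempty_of_isOpen (hC i).isOpen_compl)

/-- If the limit box met the interior part of the limit of `𝒞` at `G`, take a basic Vietoris
neighbourhood of `G` that is eventually inside `𝒞 n`. Its open sets are eventually not contained in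
`D n`, and for each `i < N` one of them is not contained in `C i n`. Finitely many points chosen
outside form a compact set in both the box and `𝒞 n`. -/
theorem disjoint_box_regularLimit {I : Type*} {l : Ultrafilter I} {D : I → Set X}
    {C : ℕ → I → Set X} {𝒞 : I → Set (NonemptyCompacts X)} (hDC : ∀ i n, D n ⊆ C i n) {N : ℕ}
    (hN : ∀ i, N ≤ i → C i = D) (h : ∀ n, Disjoint (box (D n) fun i => C i n) (𝒞 n)) :
    Disjoint (box (regularLimit (l : Filter I) D) fun i => regularLimit (l : Filter I) (C i))
      (regularLimit (l : Filter I) 𝒞) := by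
  refine Disjoint.closure_right ?_ (isOpen_box (isRegularlyClosed_regularLimit _ _).isClosed
    (fun i => (isRegularlyClosed_regularLimit _ _).isClosed) (N := N) fun i hi => by rw [hN i hi])
  rw [Set.disjoint_left]
  rintro G ⟨hGD, hGC⟩ ⟨O, hO, hOC⟩
  obtain ⟨_, ⟨u, ⟨hu, hu', hopen⟩, rfl⟩, ⟨hGu, hGu'⟩, huO⟩ :=
    isTopologicalBasis.mem_nhds_iff.1 hO
  have h₁ : ∀ᶠ n in (l : Filter I), ∀ U ∈ u, ¬ U ⊆ D n := by
    rw [eventually_all_finite hu]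
    intro U hU
    obtain ⟨p, hpG, hpU⟩ := hGu' U hU
    exact eventually_not_subset_of_notMem_regularLimit (hGD.notMem_of_mem_left hpG)
      ((hopen U hU).mem_nhds hpU)
  have h₂ : ∀ᶠ n in (l : Filter I), ∀ i ∈ Iio N, ∃ U ∈ u, ¬ U ⊆ C i n := by
    rw [eventually_all_finite (finite_Iio N)]
    intro i _
    obtain ⟨p, hpG, hpC⟩ := not_subset.1 (hGC i)
    obtain ⟨U, hU, hpU⟩ := hGu hpG
    exact (eventually_not_subset_of_notMem_regularLimit hpC ((hopen U hU).mem_nhds hpU)).mono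
      fun n hn => ⟨U, hU, hn⟩
  obtain ⟨n, hn₁, hn₂, hn₃⟩ := (h₁.and (h₂.and hOC)).exists
  simp only [not_subset] at hn₁ hn₂
  have : Nonempty X := G.nonempty.to_type
  choose! q hqU hqD using hn₁
  choose! W hW p hpW hpC using hn₂
  have hfin : (q '' u ∪ p '' Iio N).Finite := (hu.image q).union ((finite_Iio N).image p)
  let F : NonemptyCompacts X := ⟨⟨q '' u ∪ p '' Iio N, hfin.isCompact⟩, (hu'.image q).inl⟩
  have hF : (F : Set X) = q '' u ∪ p '' Iio N := rfl
  have hFD : Disjoint (F : Set X) (D n) := by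
    rw [hF, Set.disjoint_left]
    rintro _ (⟨U, hU, rfl⟩ | ⟨i, hi, rfl⟩) hmem
    · exact hqD U hU hmem
    · exact hpC i hi (hDC i n hmem)
  refine (Set.disjoint_left.1 (h n)) (a := F) ⟨hFD, fun i hi => ?_⟩ (hn₃ (huO ⟨?_, ?_⟩))
  · rcases lt_or_ge i N with hiN | hiN
    · exact hpC i hiN (hi (Or.inr ⟨i, hiN, rfl⟩))
    · simp only [hN i hiN] at hi
      obtain ⟨x, hx⟩ := F.nonempty
      exact hFD.notMem_of_mem_left hx (hi hx)
  · rintro _ (⟨U, hU, rfl⟩ | ⟨i, hi, rfl⟩)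
    · exact ⟨U, hU, hqU U hU⟩
    · exact ⟨W i, hW i hi, hpW i hi⟩
  · exact fun U hU => ⟨q U, Or.inl ⟨U, hU, rfl⟩, hqU U hU⟩

end TopologicalSpace.NonemptyCompacts

/-! ### Witnesses and the distance on the hyperspace. -/

section Hyperspace

open NonemptyCompacts

variable {X : Type u} [TopologicalSpace X] {ρ : X → Set X → ℝ≥0}

/-- The regularly closed sets `D` and `C i` witness that `K` has `ρ`-distance at least `ε` from the
set `𝒞` of compacta: their box misses `𝒞`, and the `ρ`-distances certifying that `K` is in the box
are at least `ε`. At most `1 / ε` of the sets `C i` may differ from `D`. -/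
structure IsDistanceWitness (ρ : X → Set X → ℝ≥0) (K : NonemptyCompacts X)
    (𝒞 : Set (NonemptyCompacts X)) (ε : ℝ≥0) (D : Set X) (C : ℕ → Set X) : Prop where
  base_regular : IsRegularlyClosed D
  regular : ∀ i, IsRegularlyClosed (C i)
  base_subset : ∀ i, D ⊆ C i
  eq_base : ∀ i : ℕ, 1 < (i + 1) * ε → C i = D
  le_base : ∀ x ∈ K, ε ≤ ρ x D
  exists_le : ∀ i, ∃ x ∈ K, ε ≤ ρ x (C i)
  disjoint_box : Disjoint (box D C) 𝒞

/-- The distance on the hyperspace induced by a function `ρ` of a point and a closed set. -/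
noncomputable def hyperDist (ρ : X → Set X → ℝ≥0) (K : NonemptyCompacts X)
    (𝒞 : Set (NonemptyCompacts X)) : ℝ≥0 :=
  sSup {ε | ∃ D C, IsDistanceWitness ρ K 𝒞 ε D C}

theorem exists_forall_one_lt_mul {ε : ℝ≥0} (hε : 0 < ε) :
    ∃ N : ℕ, ∀ i : ℕ, N ≤ i → 1 < (i + 1) * ε := by
  obtain ⟨N, hN⟩ := exists_nat_gt (1 / ε)
  refine ⟨N, fun i hi => ?_⟩
  rw [div_lt_iff₀ hε] at hN
  refine hN.trans_le (mul_le_mul_left ?_ ε)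
  exact_mod_cast hi.trans i.le_succ

namespace IsDistanceWitness

variable {K : NonemptyCompacts X} {𝒞 : Set (NonemptyCompacts X)} {ε : ℝ≥0} {D : Set X}
  {C : ℕ → Set X}

theorem anti (h : IsDistanceWitness ρ K 𝒞 ε D C) {𝒞' : Set (NonemptyCompacts X)} (h𝒞 : 𝒞' ⊆ 𝒞) :
    IsDistanceWitness ρ K 𝒞' ε D C :=
  { h with disjoint_box := h.disjoint_box.mono_right h𝒞 }

/-- A smaller scale permits more exceptional sets, so only the estimates on `ρ` need rechecking. -/
theorem of_le (h : IsDistanceWitness ρ K 𝒞 ε D C) {L : NonemptyCompacts X} {δ : ℝ≥0} (hδ : δ ≤ ε)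
    (hD : ∀ x ∈ L, δ ≤ ρ x D) (hC : ∀ i, ∃ x ∈ L, δ ≤ ρ x (C i)) :
    IsDistanceWitness ρ L 𝒞 δ D C :=
  { h with
    eq_base := fun i hi => h.eq_base i (hi.trans_le (mul_le_mul_right hδ _))
    le_base := hD
    exists_le := hC }

theorem exists_eq_base (h : IsDistanceWitness ρ K 𝒞 ε D C) (hε : 0 < ε) :
    ∃ N : ℕ, ∀ i, N ≤ i → C i = D :=
  (exists_forall_one_lt_mul hε).imp fun _ hN i hi => h.eq_base i (hN i hi)

theorem le_empty (h : IsDistanceWitness ρ K 𝒞 ε D C) (hρ : IsQuasiKappaMetric ρ) {x : X}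
    (hx : x ∈ K) : ε ≤ ρ x ∅ :=
  (h.le_base x hx).trans (hρ.anti _ _ isRegularlyClosed_empty h.base_regular (empty_subset D) x)

theorem mem_box (h : IsDistanceWitness ρ K 𝒞 ε D C) (hρ : IsQuasiKappaMetric ρ) (hε : 0 < ε) :
    K ∈ box D C := by
  refine ⟨Set.disjoint_left.2 fun x hx hxD => ?_, fun i hi => ?_⟩
  · exact hε.not_ge ((h.le_base x hx).trans (hρ.eq_zero_of_mem h.base_regular hxD).le)
  · obtain ⟨x, hx, hle⟩ := h.exists_le i
    exact hε.not_ge (hle.trans (hρ.eq_zero_of_mem (h.regular i) (hi hx)).le)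

/-- Witnesses pass to limits along ultrafilters, simultaneously in the compact set and in the set
of compacta. -/
theorem regularLimit (hρ : IsQuasiKappaMetric ρ) {I : Type u} {l : Ultrafilter I}
    {H : I → NonemptyCompacts X} (hH : Tendsto H l (𝓝 K)) {𝒞 : I → Set (NonemptyCompacts X)}
    (hε : 0 < ε) {D : I → Set X} {C : I → ℕ → Set X}
    (h : ∀ n, IsDistanceWitness ρ (H n) (𝒞 n) ε (D n) (C n)) :
    IsDistanceWitness ρ K (regularLimit (l : Filter I) 𝒞) ε (regularLimit (l : Filter I) D)
      fun i => _root_.regularLimit (l : Filter I) fun n => C n i where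
  base_regular := isRegularlyClosed_regularLimit _ _
  regular i := isRegularlyClosed_regularLimit _ _
  base_subset i := regularLimit_mono fun n => (h n).base_subset i
  eq_base i hi := congrArg _ (funext fun n => (h n).eq_base i hi)
  le_base x hx := by
    refine hρ.le_regularLimit fun S hS => ?_
    have hrc : IsRegularlyClosed (closure (interior (⋂ n ∈ S, D n))) :=
      isOpen_interior.isRegularlyClosed_closure
    have hcl : IsClosed {x | ε ≤ ρ x (closure (interior (⋂ n ∈ S, D n)))} :=
      isClosed_le continuous_const (hρ.cont _ hrc)
    refine (isClosed_subsets_of_isClosed hcl).mem_of_tendsto hH ?_ hx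
    filter_upwards [hS] with n hn y hy
    exact ((h n).le_base y hy).trans (hρ.anti _ _ hrc (h n).base_regular (closure_minimal
      (interior_subset.trans (biInter_subset_of_mem hn)) (h n).base_regular.isClosed) _)
  exists_le i := by
    choose x hx hle using fun n => (h n).exists_le i
    obtain ⟨y, hy, hxy⟩ := exists_tendsto_of_mem hH hx
    exact ⟨y, hy, hρ.le_regularLimit_of_tendsto (fun n => (h n).regular i) hxy hle⟩
  disjoint_box := by
    obtain ⟨N, hN⟩ := exists_forall_one_lt_mul hε
    exact disjoint_box_regularLimit (fun i n => (h n).base_subset i)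
      (fun i hi => funext fun n => (h n).eq_base i (hN i hi)) fun n => (h n).disjoint_box

end IsDistanceWitness

/-! ### The quasi κ-metric axioms for the hyperspace. -/

namespace IsQuasiKappaMetric

variable {K : NonemptyCompacts X} {𝒞 : Set (NonemptyCompacts X)}

theorem le_hyperDist (hρ : IsQuasiKappaMetric ρ) {ε : ℝ≥0} {D : Set X} {C : ℕ → Set X}
    (h : IsDistanceWitness ρ K 𝒞 ε D C) : ε ≤ hyperDist ρ K 𝒞 := by
  obtain ⟨x, hx⟩ := K.nonempty
  exact le_csSup ⟨ρ x ∅, fun δ ⟨_, _, hδ⟩ => hδ.le_empty hρ hx⟩ ⟨D, C, h⟩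

theorem exists_witness_of_lt_hyperDist {δ : ℝ≥0} (h : δ < hyperDist ρ K 𝒞) :
    ∃ ε, δ < ε ∧ ∃ D C, IsDistanceWitness ρ K 𝒞 ε D C := by
  have hne : {ε | ∃ D C, IsDistanceWitness ρ K 𝒞 ε D C}.Nonempty := by
    by_contra hempty
    rw [hyperDist, not_nonempty_iff_eq_empty.1 hempty, csSup_empty] at h
    exact not_lt_bot h
  obtain ⟨ε, hε, hlt⟩ := exists_lt_of_lt_csSup hne h
  exact ⟨ε, hlt, hε⟩

theorem hyperDist_anti (hρ : IsQuasiKappaMetric ρ) {𝒞' : Set (NonemptyCompacts X)} (h : 𝒞 ⊆ 𝒞')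
    (K : NonemptyCompacts X) : hyperDist ρ K 𝒞' ≤ hyperDist ρ K 𝒞 := by
  refine le_of_forall_lt fun δ hδ => ?_
  obtain ⟨ε, hδε, D, C, hε⟩ := exists_witness_of_lt_hyperDist hδ
  exact hδε.trans_le (hρ.le_hyperDist (hε.anti h))

theorem le_hyperDist_regularLimit (hρ : IsQuasiKappaMetric ρ) {I : Type u} {l : Ultrafilter I}
    {H : I → NonemptyCompacts X} (hH : Tendsto H l (𝓝 K)) {𝒞 : I → Set (NonemptyCompacts X)}
    {ε : ℝ≥0} (h : ∀ n, ε ≤ hyperDist ρ (H n) (𝒞 n)) :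
    ε ≤ hyperDist ρ K (regularLimit (l : Filter I) 𝒞) := by
  -- Below `ε` actual witnesses exist; lowering all of them to the common scale `δ` bounds their
  -- numbers of exceptional sets uniformly.
  refine le_of_forall_lt_imp_le_of_dense fun δ hδ => ?_
  rcases eq_zero_or_pos δ with rfl | hpos
  · exact bot_le
  choose η hη D C hw using fun n => exists_witness_of_lt_hyperDist (hδ.trans_le (h n))
  exact hρ.le_hyperDist (IsDistanceWitness.regularLimit hρ hH hpos fun n =>
    (hw n).of_le (hη n).le (fun x hx => (hη n).le.trans ((hw n).le_base x hx))
      fun i => ((hw n).exists_le i).imp fun x hx => ⟨hx.1, (hη n).le.trans hx.2⟩)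

theorem isOpen_lt_hyperDist (hρ : IsQuasiKappaMetric ρ) (𝒞 : Set (NonemptyCompacts X)) (δ : ℝ≥0) :
    IsOpen {K | δ < hyperDist ρ K 𝒞} := by
  refine isOpen_iff_mem_nhds.2 fun K hK => ?_
  obtain ⟨ε, hδε, D, C, hε⟩ := exists_witness_of_lt_hyperDist hK
  obtain ⟨η, hδη, hηε⟩ := exists_between hδε
  obtain ⟨N, hN⟩ := hε.exists_eq_base (bot_le.trans_lt hδε)
  have hD : ∀ᶠ L : NonemptyCompacts X in 𝓝 K, (L : Set X) ⊆ {x | η < ρ x D} :=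
    (isOpen_subsets_of_isOpen (isOpen_lt continuous_const (hρ.cont D hε.base_regular))).mem_nhds
      fun x hx => hηε.trans_le (hε.le_base x hx)
  have hC : ∀ᶠ L : NonemptyCompacts X in 𝓝 K, ∀ i ∈ Iio N,
      ((L : Set X) ∩ {x | η < ρ x (C i)}).Nonempty := by
    refine (eventually_all_finite (finite_Iio N)).2 fun i _ => (isOpen_inter_nonempty_of_isOpen
      (isOpen_lt continuous_const (hρ.cont _ (hε.regular i)))).mem_nhds ?_
    obtain ⟨x, hx, hle⟩ := hε.exists_le i
    exact ⟨x, hx, hηε.trans_le hle⟩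
  filter_upwards [hD, hC] with L hLD hLC
  refine hδη.trans_le (hρ.le_hyperDist
    (hε.of_le hηε.le (fun x hx => (hLD hx).le) fun i => ?_))
  rcases lt_or_ge i N with hiN | hiN
  · obtain ⟨x, hx, hlt⟩ := hLC i hiN
    exact ⟨x, hx, hlt.le⟩
  · obtain ⟨x, hx⟩ := L.nonempty
    exact ⟨x, hx, by rw [hN i hiN]; exact (hLD hx).le⟩

theorem isClosed_le_hyperDist (hρ : IsQuasiKappaMetric ρ) (h𝒞 : IsRegularlyClosed 𝒞) (δ : ℝ≥0) :
    IsClosed {K | δ ≤ hyperDist ρ K 𝒞} := by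
  refine isClosed_of_closure_subset fun K hK => ?_
  have := mem_closure_iff_comap_neBot.1 hK
  let l := Ultrafilter.of (comap ((↑) : {K | δ ≤ hyperDist ρ K 𝒞} → NonemptyCompacts X) (𝓝 K))
  exact (hρ.le_hyperDist_regularLimit (l := l) (tendsto_comap.mono_left (Ultrafilter.of_le _))
    fun L => L.2).trans (hρ.hyperDist_anti (subset_regularLimit h𝒞
      (Eventually.of_forall fun _ => subset_rfl)) K)

theorem continuous_hyperDist (hρ : IsQuasiKappaMetric ρ) (h𝒞 : IsRegularlyClosed 𝒞) :
    Continuous fun K => hyperDist ρ K 𝒞 := by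
  refine OrderTopology.continuous_iff.2 fun δ => ⟨hρ.isOpen_lt_hyperDist 𝒞 δ, ?_⟩
  convert! (hρ.isClosed_le_hyperDist h𝒞 δ).isOpen_compl using 1
  ext K
  simp

theorem hyperDist_closure_iUnion (hρ : IsQuasiKappaMetric ρ) {ι : Type u} [LinearOrder ι]
    [Nonempty ι] {𝒞 : ι → Set (NonemptyCompacts X)} (h𝒞 : ∀ i, IsRegularlyClosed (𝒞 i))
    (hmono : Monotone 𝒞) (K : NonemptyCompacts X) :
    hyperDist ρ K (closure (⋃ i, 𝒞 i)) = ⨅ i, hyperDist ρ K (𝒞 i) := by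
  refine (le_ciInf fun i => hρ.hyperDist_anti
    ((subset_iUnion 𝒞 i).trans subset_closure) K).antisymm ?_
  -- Each `𝒞 i` is eventually contained in `𝒞 j`, so the limit along `l` contains the whole union.
  obtain ⟨l, hl⟩ := Ultrafilter.exists_le (atTop : Filter ι)
  refine (hρ.le_hyperDist_regularLimit (l := l) tendsto_const_nhds
    fun i => ciInf_le (OrderBot.bddBelow _) i).trans (hρ.hyperDist_anti ?_ K)
  refine closure_minimal (iUnion_subset fun i => subset_regularLimit (h𝒞 i) (hl ?_))
    isClosed_closure
  exact (eventually_ge_atTop i).mono fun j hj => hmono hj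

/-- Shrink the open sets of a basic neighbourhood missing `𝒞` to closed sets `T U`. The complements
of the `T U` and of their union yield a box inside that neighbourhood. As positivity of `ρ` holds on
dense open sets, each `interior (T U)` has a point at positive distance from both relevant sets;
these points form the nearby `F`. -/
theorem compl_subset_closure_pos_hyperDist [RegularSpace X] (hρ : IsQuasiKappaMetric ρ)
    (h𝒞 : IsClosed 𝒞) : 𝒞ᶜ ⊆ closure {K | 0 < hyperDist ρ K 𝒞} := by
  intro G hG
  rw [mem_closure_iff_nhds]
  intro O hO
  obtain ⟨_, ⟨u, ⟨hu, hu', hopen⟩, rfl⟩, ⟨hGu, hGu'⟩, huO⟩ :=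
    NonemptyCompacts.isTopologicalBasis.mem_nhds_iff.1 (inter_mem hO (h𝒞.isOpen_compl.mem_nhds hG))
  have hT : ∀ U : u, ∃ T : Set X, (interior T).Nonempty ∧ IsClosed T ∧ T ⊆ U := fun U => by
    obtain ⟨p, -, hp⟩ := hGu' U U.2
    obtain ⟨T, hT, hcl, hTU⟩ := exists_mem_nhds_isClosed_subset ((hopen U U.2).mem_nhds hp)
    exact ⟨T, ⟨p, mem_interior_iff_mem_nhds.2 hT⟩, hcl, hTU⟩
  choose T hTne hTcl hTU using hT
  have := hu.to_subtype
  have := hu'.to_subtype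
  set D : Set X := closure (⋃ U, T U)ᶜ with hDdef
  have hD : IsRegularlyClosed D :=
    (isClosed_iUnion_of_finite hTcl).isOpen_compl.isRegularlyClosed_closure
  have hA : ∀ U, IsRegularlyClosed (closure (T U)ᶜ) := fun U =>
    (hTcl U).isOpen_compl.isRegularlyClosed_closure
  have hDA : ∀ U, D ⊆ closure (T U)ᶜ := fun U =>
    closure_mono (compl_subset_compl.2 (subset_iUnion T U))
  have hy : ∀ U, ∃ y ∈ interior (T U), 0 < ρ y D ∧ 0 < ρ y (closure (T U)ᶜ) := fun U => by
    obtain ⟨V, hV, -, hVd, hVρ⟩ := hρ.pos_iff D hD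
    obtain ⟨W, hW, -, hWd, hWρ⟩ := hρ.pos_iff _ (hA U)
    obtain ⟨p, hp⟩ := hTne U
    have hsub : interior (T U) ⊆ (closure (T U)ᶜ)ᶜ := by rw [closure_compl, compl_compl]
    obtain ⟨q, hq, hqW⟩ := mem_closure_iff.1 (hWd (hsub hp)) _ isOpen_interior hp
    obtain ⟨y, ⟨hy, hyW⟩, hyV⟩ := mem_closure_iff.1 (hVd fun hqD => hsub hq (hDA U hqD)) _
      (isOpen_interior.inter hW) ⟨hq, hqW⟩
    exact ⟨y, hy, (hVρ y).2 hyV, (hWρ y).2 hyW⟩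
  choose y hyT hyD hyA using hy
  let F : NonemptyCompacts X := ⟨⟨range y, (finite_range y).isCompact⟩, range_nonempty y⟩
  have hF : ∀ U, y U ∈ F := fun U => mem_range_self U
  refine ⟨F, (huO ⟨?_, ?_⟩).1, ?_⟩
  · rintro _ ⟨U, rfl⟩
    exact ⟨U, U.2, hTU U (interior_subset (hyT U))⟩
  · exact fun U hU => ⟨y ⟨U, hU⟩, mem_range_self _, hTU ⟨U, hU⟩ (interior_subset (hyT _))⟩
  -- The condition `m * ε ≤ 1` leaves room for `m` exceptional sets, one for each `U`.
  obtain ⟨m, ⟨e⟩⟩ := Finite.exists_equiv_fin u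
  obtain ⟨ε, hε, hm, hεD, hεA⟩ : ∃ ε : ℝ≥0, 0 < ε ∧ (m : ℝ≥0) * ε ≤ 1 ∧ (∀ U, ε ≤ ρ (y U) D) ∧
      ∀ U, ε ≤ ρ (y U) (closure (T U)ᶜ) := by
    have h₁ : ∀ᶠ ε : ℝ≥0 in 𝓝[>] 0, ε < 1 / (m + 1) :=
      (eventually_lt_nhds (by positivity)).filter_mono nhdsWithin_le_nhds
    have h₂ : ∀ᶠ ε in 𝓝[>] (0 : ℝ≥0), ∀ U, ε < ρ (y U) D :=
      eventually_all.2 fun U => (eventually_lt_nhds (hyD U)).filter_mono nhdsWithin_le_nhds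
    have h₃ : ∀ᶠ ε in 𝓝[>] (0 : ℝ≥0), ∀ U, ε < ρ (y U) (closure (T U)ᶜ) :=
      eventually_all.2 fun U => (eventually_lt_nhds (hyA U)).filter_mono nhdsWithin_le_nhds
    obtain ⟨ε, h₁, h₂, h₃, h₄⟩ := (h₁.and (h₂.and (h₃.and self_mem_nhdsWithin))).exists
    refine ⟨ε, h₄, ?_, fun U => (h₂ U).le, fun U => (h₃ U).le⟩
    rw [lt_div_iff₀' (by positivity)] at h₁
    exact (mul_le_mul_left (le_add_of_nonneg_right zero_le_one) ε).trans h₁.le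
  let C : ℕ → Set X := fun i => if h : i < m then closure (T (e.symm ⟨i, h⟩))ᶜ else D
  have hCpos : ∀ U, C (e U) = closure (T U)ᶜ := fun U => by simp [C]
  have hCneg : ∀ i, m ≤ i → C i = D := fun i hi => dif_neg hi.not_gt
  have hcases : ∀ i : ℕ, (∃ U, i = e U) ∨ m ≤ i := fun i => by
    rcases lt_or_ge i m with hi | hi
    · exact Or.inl ⟨e.symm ⟨i, hi⟩, by simp⟩
    · exact Or.inr hi
  refine hε.trans_le (hρ.le_hyperDist (D := D) (C := C) ⟨hD, ?_, ?_, ?_, ?_, ?_, ?_⟩)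
  · intro i
    obtain ⟨U, rfl⟩ | hi := hcases i
    · exact hCpos U ▸ hA U
    · exact hCneg i hi ▸ hD
  · intro i
    obtain ⟨U, rfl⟩ | hi := hcases i
    · exact hCpos U ▸ hDA U
    · exact (hCneg i hi).ge
  · refine fun i hi => hCneg i (not_lt.1 fun him => hi.not_ge (le_trans ?_ hm))
    exact mul_le_mul_left (by exact_mod_cast him) ε
  · rintro _ ⟨U, rfl⟩
    exact hεD U
  · intro i
    obtain ⟨U, rfl⟩ | hi := hcases i
    · exact ⟨y U, hF U, hCpos U ▸ hεA U⟩
    · obtain ⟨U⟩ := ‹Nonempty u›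
      exact ⟨y U, hF U, hCneg i hi ▸ hεD U⟩
  · refine Set.disjoint_left.2 fun H hH => (huO ⟨?_, ?_⟩).2
    · intro x hx
      obtain ⟨U, hxU⟩ : ∃ U, x ∈ T U := by
        by_contra hcon
        exact hH.1.notMem_of_mem_left hx (subset_closure (by simpa using hcon))
      exact ⟨U, U.2, hTU U hxU⟩
    · intro U hU
      obtain ⟨x, hx, hxC⟩ := not_subset.1 (hH.2 (e ⟨U, hU⟩))
      rw [hCpos] at hxC
      exact ⟨x, hx, hTU ⟨U, hU⟩ (not_not.1 fun hxT => hxC (subset_closure hxT))⟩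

theorem isQuasiKappaMetric_hyperDist [RegularSpace X] (hρ : IsQuasiKappaMetric ρ) :
    IsQuasiKappaMetric (hyperDist ρ) where
  pos_iff 𝒞 h𝒞 := by
    refine ⟨{K | 0 < hyperDist ρ K 𝒞}, hρ.isOpen_lt_hyperDist 𝒞 0, fun K hK hK𝒞 => ?_,
      hρ.compl_subset_closure_pos_hyperDist h𝒞.isClosed, fun _ => Iff.rfl⟩
    obtain ⟨ε, hε, D, C, h⟩ := exists_witness_of_lt_hyperDist hK
    exact Set.disjoint_left.1 h.disjoint_box (h.mem_box hρ hε) hK𝒞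
  anti _ _ _ _ h := hρ.hyperDist_anti h
  cont _ h𝒞 := hρ.continuous_hyperDist h𝒞
  closure_iUnion _ _ _ _ _ h𝒞 hmono := hρ.hyperDist_closure_iUnion h𝒞 hmono

end IsQuasiKappaMetric

/-! ### Regularity of the hyperspace distance. -/

theorem IsRegularQuasiKappaMetric.le_closure_interior_add (hρ : IsRegularQuasiKappaMetric ρ)
    {C : Set X} (hC : IsRegularlyClosed C) (x : X) (s : ℝ≥0) :
    ρ x C ≤ ρ x (closure (interior {y | ρ y C ≤ s})) + s := by
  rw [← ENNReal.coe_le_coe, ENNReal.coe_add]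
  refine (hρ.le_add_sup C _ hC isOpen_interior.isRegularlyClosed_closure x).trans
    (add_le_add_right (iSup₂_le fun y hy => ENNReal.coe_le_coe.2 ?_) _)
  exact closure_minimal interior_subset (isClosed_le (hρ.cont C hC) continuous_const) hy

/-- Shrinking the complements of the sets of a witness to where the distance exceeds `s`. -/
theorem IsDistanceWitness.tsub (hρ : IsRegularQuasiKappaMetric ρ) {s : ℝ≥0} {K : NonemptyCompacts X}
    {𝒞 : Set (NonemptyCompacts X)} {ε : ℝ≥0} {D : Set X} {C : ℕ → Set X} (hs : s < ε)
    (h : IsDistanceWitness ρ K 𝒞 ε D C) {𝒞' : Set (NonemptyCompacts X)}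
    (h𝒞' : IsRegularlyClosed 𝒞') (hle : ∀ G ∈ 𝒞', hyperDist ρ G 𝒞 ≤ s) :
    IsDistanceWitness ρ K 𝒞' (ε - s) (closure (interior {x | ρ x D ≤ s}))
      fun i => closure (interior {x | ρ x (C i) ≤ s}) where
  base_regular := isOpen_interior.isRegularlyClosed_closure
  regular i := isOpen_interior.isRegularlyClosed_closure
  base_subset i := closure_mono (interior_mono fun x hx =>
    (hρ.anti _ _ h.base_regular (h.regular i) (h.base_subset i) x).trans hx)
  eq_base i hi := by
    rw [h.eq_base i (hi.trans_le (mul_le_mul_right tsub_le_self _))]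
  le_base x hx := tsub_le_iff_right.2
    ((h.le_base x hx).trans (hρ.le_closure_interior_add h.base_regular x s))
  exists_le i := by
    obtain ⟨x, hx, hxε⟩ := h.exists_le i
    exact ⟨x, hx, tsub_le_iff_right.2 (hxε.trans (hρ.le_closure_interior_add (h.regular i) x s))⟩
  disjoint_box := by
    obtain ⟨N, hN⟩ := h.exists_eq_base (bot_le.trans_lt hs)
    -- The limit along a principal ultrafilter is the closure of the interior, so it suffices that
    -- the box of the raw sublevel sets misses `𝒞'`.
    have := disjoint_box_regularLimit (l := (pure () : Ultrafilter Unit))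
      (D := fun _ => {x | ρ x D ≤ s}) (C := fun i _ => {x | ρ x (C i) ≤ s}) (𝒞 := fun _ => 𝒞')
      (fun i _ x hx => (hρ.anti _ _ h.base_regular (h.regular i) (h.base_subset i) x).trans hx)
      (N := N) (fun i hi => by rw [hN i hi]) fun _ => ?_
    · simp only [Ultrafilter.coe_pure, regularLimit_pure] at this
      rwa [h𝒞'] at this
    rw [Set.disjoint_left]
    rintro G ⟨hGD, hGC⟩ hG
    -- For `G ∈ 𝒞'` in that box, compactness and the finiteness of the exceptional sets give a scale
    -- `δ > s` at which `D` and `C` witness the distance from `G` to `𝒞`, contradicting `hle`.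
    obtain ⟨xD, hxD, hmin⟩ := G.isCompact.exists_isMinOn G.nonempty
      (hρ.cont D h.base_regular).continuousOn
    simp only [not_subset, Set.mem_ofPred_eq, not_le] at hGC
    choose x hxG hx using hGC
    have hD : s < ρ xD D := not_le.1 fun hle => hGD.notMem_of_mem_left hxD hle
    obtain ⟨δ, hδ, hsδ⟩ : ∃ δ, (∀ i ∈ Iio N, δ ≤ ρ (x i) (C i)) ∧ s < δ ∧ δ ≤ ε ∧ δ ≤ ρ xD D := by
      have h₁ : ∀ᶠ δ in 𝓝[>] s, ∀ i ∈ Iio N, δ < ρ (x i) (C i) :=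
        (eventually_all_finite (finite_Iio N)).2 fun i _ =>
          (eventually_lt_nhds (hx i)).filter_mono nhdsWithin_le_nhds
      have h₂ : ∀ᶠ δ in 𝓝[>] s, δ < min ε (ρ xD D) :=
        (eventually_lt_nhds (lt_min hs hD)).filter_mono nhdsWithin_le_nhds
      have : (𝓝[>] s).NeBot := nhdsGT_neBot_of_exists_gt ⟨ε, hs⟩
      obtain ⟨δ, h₁, h₂, h₃⟩ := (h₁.and (h₂.and self_mem_nhdsWithin)).exists
      exact ⟨δ, fun i hi => (h₁ i hi).le, h₃, (h₂.trans_le (min_le_left _ _)).le,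
        (h₂.trans_le (min_le_right _ _)).le⟩
    refine hsδ.1.not_ge ((hρ.le_hyperDist (h.of_le hsδ.2.1 (fun y hy => hsδ.2.2.trans (hmin hy))
      fun i => ?_)).trans (hle G hG))
    rcases lt_or_ge i N with hiN | hiN
    · exact ⟨x i, hxG i, hδ i hiN⟩
    · exact ⟨xD, hxD, by rw [hN i hiN]; exact hsδ.2.2⟩

theorem IsRegularQuasiKappaMetric.isRegularQuasiKappaMetric_hyperDist [RegularSpace X]
    (hρ : IsRegularQuasiKappaMetric ρ) : IsRegularQuasiKappaMetric (hyperDist ρ) where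
  toIsQuasiKappaMetric := hρ.isQuasiKappaMetric_hyperDist
  le_add_sup 𝒞 𝒞' h𝒞 h𝒞' K := by
    by_contra! hlt
    obtain ⟨s, hs⟩ : ∃ s : ℝ≥0, (s : ℝ≥0∞) = ⨆ G ∈ 𝒞', (hyperDist ρ G 𝒞 : ℝ≥0∞) :=
      ⟨_, ENNReal.coe_toNNReal (ne_top_of_le_ne_top
        (hlt.trans ENNReal.coe_lt_top).ne le_add_self)⟩
    rw [← hs] at hlt
    have hle : ∀ G ∈ 𝒞', hyperDist ρ G 𝒞 ≤ s := fun G hG => by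
      rw [← ENNReal.coe_le_coe, hs]
      exact le_iSup₂ (f := fun G (_ : G ∈ 𝒞') => (hyperDist ρ G 𝒞 : ℝ≥0∞)) G hG
    obtain ⟨ε, hε, D, C, h⟩ :=
      IsQuasiKappaMetric.exists_witness_of_lt_hyperDist (by exact_mod_cast hlt)
    exact hε.not_ge (tsub_le_iff_right.1 (hρ.le_hyperDist (h.tsub hρ (le_add_self.trans_lt hε) h𝒞'
      hle)))

end Hyperspace

/-- `NonemptyCompacts X` is the type of non-empty compact subsets of `X`; its topology in Mathlib
is the Vietoris topology. -/
theorem proposition3p10 (X : Type u) [TopologicalSpace X] [T35Space X] :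
    (QuasiKappaMetrizable X → QuasiKappaMetrizable (NonemptyCompacts X)) ∧
    (RegularlyQuasiKappaMetrizable X → RegularlyQuasiKappaMetrizable (NonemptyCompacts X)) :=
  ⟨fun ⟨ρ, hρ⟩ => ⟨hyperDist ρ, hρ.isQuasiKappaMetric_hyperDist⟩,
    fun ⟨ρ, hρ⟩ => ⟨hyperDist ρ, hρ.isRegularQuasiKappaMetric_hyperDist⟩⟩
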